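/- Let $(W,S)$ be a finite Coxeter system with length function $\ell$; write $D(w)=\{s\in S:\ell(ws)<\ell(w)\}$ for $w\in W$. For $I\subseteq S$ let $W_I=\langle I\rangle$, $W^I=\{w\in W: D(w)\cap I=\emptyset\}$ and ${}^IW=\{w\in W: D(w^{-1})\cap I=\emptyset\}$. Then $(W_I,I)$ is a finite Coxeter system, and each $w\in W$ has unique factorizations $w=w_I\cdot{}^Iw$ with $w_I\in W_I$, ${}^Iw\in{}^IW$, and $w=w^I\cdot{}_Iw$ with $w^I\in W^I$, ${}_Iw\in W_I$. Identify a subset of $W$ with the sum of its elements in $\mathbb ZW$, and define linear maps $$\mu_I^S,\ \bar\mu_I^S:\mathbb ZW_I\to\mathbb ZW,\quad \mu_I^S(u)=W^I\cdot u,\quad \bar\mu_I^S(u)=u\cdot{}^IW,$$ $$\rho_I^S,\ \bar\rho_I^S:\mathbb ZW\to\mathbb ZW_I,\quad \rho_I^S(w)=w_I,\quad \bar\rho_I^S(w)={}_Iw .$$ Let $(\ )^{-1}:\mathbb ZW\to\mathbb ZW$ be the linear map with $w\mapsto w^{-1}$. Let $\Sigma(W)\subseteq\mathbb ZW$ be the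 $\mathbb Z$-span of the sums $D_J(W)=\sum_{D(w)=J}w$, $J\subseteq S$ (the descent algebra), let $\imath:\Sigma(W)\hookrightarrow\mathbb ZW$ be the inclusion, let $\Sigma^*(W)=\operatorname{Hom}_{\mathbb Z}(\Sigma(W),\mathbb Z)$, and let $\chi:\mathbb ZW\to\Sigma^*(W)$ be the linear map for which $\chi(w)$ sends $D_J(W)$ to $1$ if $J=D(w)$ and to $0$ otherwise. Put $\chi'=\chi\circ(\ )^{-1}$. (1) The maps $\mu_I^S,\rho_I^S$ restrict to maps $\mu_I^S:\Sigma(W_I)\to\Sigma(W)$ and $\rho_I^S:\Sigma(W)\to\Sigma(W_I)$, the maps $\bar\mu_I^S,\bar\rho_I^S$ descend along $\chi$ to maps $\bar\mu_I^S:\Sigma^*(W_I)\to\Sigma^*(W)$ and $\bar\rho_I^S:\Sigma^*(W)\to\Sigma^*(W_I)$, and the following diagram commutes: $$\begin{array}{ccccccc} \Sigma(W_I)&\overset{\imath}{\hookrightarrow}&\mathbb ZW_I&\overset{(\ )^{-1}}{\longleftrightarrow}&\mathbb ZW_I&\overset{\chi}{\twoheadrightarrow}&\Sigma^*(W_I)\\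 {\scriptstyle\mu_I^S}\downarrow&&{\scriptstyle\mu_I^S}\downarrow&&{\scriptstyle\bar\mu_I^S}\downarrow&&{\scriptstyle\bar\mu_I^S}\downarrow\\ \Sigma(W)&\overset{\imath}{\hookrightarrow}&\mathbb ZW&\overset{(\ )^{-1}}{\longleftrightarrow}&\mathbb ZW&\overset{\chi}{\twoheadrightarrow}&\Sigma^*(W)\\ {\scriptstyle\rho_I^S}\downarrow&&{\scriptstyle\rho_I^S}\downarrow&&{\scriptstyle\bar\rho_I^S}\downarrow&&{\scriptstyle\bar\rho_I^S}\downarrow\\ \Sigma(W_I)&\overset{\imath}{\hookrightarrow}&\mathbb ZW_I&\overset{(\ )^{-1}}{\longleftrightarrow}&\mathbb ZW_I&\overset{\chi}{\twoheadrightarrow}&\Sigma^*(W_I) \end{array}$$ Here $\imath$ is injective, $(\ )^{-1}$ bijective and $\chi$ surjective. (2) Rotating the diagram by $180^\circ$ gives a dual diagram: with respect to the perfect pairings $\langle u,v\rangle=\delta_{u,v}$ on $\mathbb ZW$ and evaluation on $\Sigma(W)\times\Sigma^*(W)$, the map $\mu_I^S$ is dual to $\bar\rho_I^S$ and $\rho_I^S$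 is dual to $\bar\mu_I^S$ (both on the group algebras and between $\Sigma$ and $\Sigma^*$), $\imath$ is dual to $\chi$, and $(\ )^{-1}$ is self-dual. (3) Let $\mathcal Cox$ be the category of finite Coxeter systems whose morphisms are the embeddings $f:(W',S')\hookrightarrow(W,S)$, i.e. the injective group homomorphisms with $f(S')\subseteq S$; $f$ identifies $(W',S')$ with $(W_I,I)$, $I=f(S')$, and so gives maps as above with $W'$ in place of $W_I$. All of (1) and (2) holds for these maps. Sending $f$ to $\mu_I^S$ gives functors $\Sigma$ and $\Omega:(W,S)\mapsto\mathbb ZW$ from $\mathcal Cox$ to $\mathbb Z$-modules, and sending $f$ to $\bar\mu_I^S$ gives functors $\Omega^*:(W,S)\mapsto\mathbb ZW$ and $\Sigma^*$ from $\mathcal Cox$ to $\mathbb Z$-modules; likewise $\rho_I^S$ (for $\Sigma,\Omega$) and $\bar\rho_I^S$ (for $\Omega^*,\Sigma^*$) give functors from $\mathcal Cox^{op}$ to $\mathbb Z$-modules. On both categories, $\imath:\Sigma\to\Omega$, $\chi:\Omega^*\to\Sigma^*$ and $\chi':\Omega\to\Sigma^*$ are natural transformations. -/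

import Mathlib

open CategoryTheory MonoidAlgebra

universe u v w

/-! ### Finite Coxeter systems and their category -/

/-- A finite Coxeter system `(W, S)`: a finite group `W` with a Coxeter presentation.  The simple
generators are indexed by `B`, that is `S = {cs.simple i : i ∈ B}`, and subsets of `S` are given as
subsets of `B`. -/
structure Cox : Type (u + 1) where
  /-- the index set of the simple generators -/
  B : Type u
  /-- the group -/
  W : Type u
  [group : Group W]
  [finite : Finite W]
  /-- the Coxeter matrix `(m_{st})` -/
  M : CoxeterMatrix B
  /-- the Coxeter presentation -/
  cs : CoxeterSystem M W

namespace Cox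

attribute [instance] Cox.group Cox.finite

/-- An embedding `(W', S') ↪ (W, S)` of Coxeter systems: an injective group homomorphism that maps
`S'` into `S`. -/
@[ext]
structure Emb (X Y : Cox.{u}) where
  /-- the underlying group homomorphism -/
  hom : X.W →* Y.W
  injective : Function.Injective hom
  map_simple : ∀ i : X.B, ∃ j : Y.B, hom (X.cs.simple i) = Y.cs.simple j

/-- The category of finite Coxeter systems and their embeddings. -/
instance : Category Cox.{u} where
  Hom X Y := Emb X Y
  id X := ⟨MonoidHom.id X.W, fun _ _ h => h, fun i => ⟨i, rfl⟩⟩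
  comp f g :=
    { hom := g.hom.comp f.hom
      injective := g.injective.comp f.injective
      map_simple := fun i => by
        obtain ⟨j, hj⟩ := f.map_simple i
        obtain ⟨k, hk⟩ := g.map_simple j
        exact ⟨k, by rw [MonoidHom.comp_apply, hj, hk]⟩ }

/-- The group homomorphism underlying a morphism. -/
def homOf {X Y : Cox.{u}} (f : X ⟶ Y) : X.W →* Y.W := Emb.hom f

/-- The subset `I ⊆ S` that is the image of `S'` under an embedding `f : (W', S') ↪ (W, S)`; `f`
identifies `(W', S')` with `(W_I, I)`. -/
def support {X Y : Cox.{u}} (f : X ⟶ Y) : Set Y.B :=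
  {j | ∃ i : X.B, homOf f (X.cs.simple i) = Y.cs.simple j}

/-- The parabolic subgroup `W_I`, generated by `I`. -/
def parabolic (X : Cox.{u}) (I : Set X.B) : Subgroup X.W :=
  Subgroup.closure (X.cs.simple '' I)

/-- The restriction of a Coxeter matrix to a subset `I` of its index set. -/
def restrictMatrix {B : Type u} (M : CoxeterMatrix B) (I : Set B) : CoxeterMatrix I where
  M := fun i j => M i j
  isSymm := by ext i j; exact M.symmetric j i
  diagonal := fun i => M.diagonal i
  off_diagonal := fun i j h => M.off_diagonal i j fun e => h (Subtype.ext e)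

/-- The Coxeter system with underlying group `W_I`, generators indexed by `I` and Coxeter matrix
the restriction of that of `(W, S)`, for a given such presentation `c` of `W_I`. -/
def subsystem (X : Cox.{u}) (I : Set X.B)
    (c : CoxeterSystem (restrictMatrix X.M I) (X.parabolic I)) : Cox.{u} where
  B := I
  W := X.parabolic I
  M := restrictMatrix X.M I
  cs := c

/-! ### Descents and coset representatives -/

/-- The descent set `D(w) = {s ∈ S : ℓ(ws) < ℓ(w)}`. -/
def descents (X : Cox.{u}) (w : X.W) : Set X.B := {i | X.cs.IsRightDescent w i}

/-- `W^I = {w ∈ W : D(w) ⊆ S \ I}`: the minimal length representatives of the left cosets `w W_I`. -/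
def leftReps (X : Cox.{u}) (I : Set X.B) : Set X.W := {w | X.descents w ⊆ Iᶜ}

/-- `^I W = {w ∈ W : D(w⁻¹) ⊆ S \ I}`: the minimal length representatives of the right cosets
`W_I w`. -/
def rightReps (X : Cox.{u}) (I : Set X.B) : Set X.W := {w | X.descents w⁻¹ ⊆ Iᶜ}

/-- Existence of the factorization `w = w_I · ^I w`. -/
theorem exists_rightFactor {X Y : Cox.{u}} (f : X ⟶ Y) (w : Y.W) :
    ∃ u : X.W, ∃ z ∈ Y.rightReps (support f), w = homOf f u * z := by
  obtain ⟨u, hu⟩ := Finite.exists_min fun u : X.W => Y.cs.length ((homOf f u)⁻¹ * w)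
  refine ⟨u, (homOf f u)⁻¹ * w, ?_, by simp⟩
  rintro j hj ⟨i, hi⟩
  have h1 : Y.cs.IsLeftDescent ((homOf f u)⁻¹ * w) j := Y.cs.isRightDescent_inv_iff.1 hj
  have h2 := hu (u * (X.cs.simple i)⁻¹)
  rw [map_mul, map_inv, hi, mul_inv_rev, inv_inv, mul_assoc] at h2
  exact absurd h1 (not_lt.2 h2)

/-- Existence of the factorization `w = w^I · _I w`. -/
theorem exists_leftFactor {X Y : Cox.{u}} (f : X ⟶ Y) (w : Y.W) :
    ∃ u : X.W, ∃ z ∈ Y.leftReps (support f), w = z * homOf f u := by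
  obtain ⟨u, z, hz, h⟩ := exists_rightFactor f w⁻¹
  exact ⟨u⁻¹, z⁻¹, hz, by rw [map_inv, ← mul_inv_rev, ← h, inv_inv]⟩

/-- `w_I`, as an element of `W' ≅ W_I`: the factor in the factorization `w = w_I · ^I w` with
`w_I ∈ W_I` and `^I w ∈ ^I W`. -/
noncomputable def rightFactor {X Y : Cox.{u}} (f : X ⟶ Y) (w : Y.W) : X.W :=
  (exists_rightFactor f w).choose

/-- `_I w`, as an element of `W' ≅ W_I`: the factor in the factorization `w = w^I · _I w` with
`w^I ∈ W^I` and `_I w ∈ W_I`. -/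
noncomputable def leftFactor {X Y : Cox.{u}} (f : X ⟶ Y) (w : Y.W) : X.W :=
  (exists_leftFactor f w).choose

/-! ### The group algebra `ℤW` and the four linear maps -/

/-- The sum in `ℤW` of the elements of a subset of `W`. -/
noncomputable def setSum (X : Cox.{u}) (A : Set X.W) : MonoidAlgebra ℤ X.W :=
  ∑ w ∈ A.toFinite.toFinset, single w 1

/-- `μ_I^S : ℤW_I → ℤW`, `u ↦ W^I · u`. -/
noncomputable def mu {X Y : Cox.{u}} (f : X ⟶ Y) :
    MonoidAlgebra ℤ X.W →ₗ[ℤ] MonoidAlgebra ℤ Y.W :=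
  LinearMap.mulLeft ℤ (Y.setSum (Y.leftReps (support f))) ∘ₗ mapDomainLinearMap ℤ ℤ (homOf f)

/-- `ρ_I^S : ℤW → ℤW_I`, `w ↦ w_I`. -/
noncomputable def rho {X Y : Cox.{u}} (f : X ⟶ Y) :
    MonoidAlgebra ℤ Y.W →ₗ[ℤ] MonoidAlgebra ℤ X.W :=
  mapDomainLinearMap ℤ ℤ (rightFactor f)

/-- `μ̄_I^S : ℤW_I → ℤW`, `u ↦ u · ^I W`. -/
noncomputable def muBar {X Y : Cox.{u}} (f : X ⟶ Y) :
    MonoidAlgebra ℤ X.W →ₗ[ℤ] MonoidAlgebra ℤ Y.W :=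
  LinearMap.mulRight ℤ (Y.setSum (Y.rightReps (support f))) ∘ₗ mapDomainLinearMap ℤ ℤ (homOf f)

/-- `ρ̄_I^S : ℤW → ℤW_I`, `w ↦ _I w`. -/
noncomputable def rhoBar {X Y : Cox.{u}} (f : X ⟶ Y) :
    MonoidAlgebra ℤ Y.W →ₗ[ℤ] MonoidAlgebra ℤ X.W :=
  mapDomainLinearMap ℤ ℤ (leftFactor f)

/-- The linear map `( )⁻¹ : ℤW → ℤW`, `w ↦ w⁻¹`. -/
noncomputable def invMap (X : Cox.{u}) : MonoidAlgebra ℤ X.W →ₗ[ℤ] MonoidAlgebra ℤ X.W :=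
  mapDomainLinearMap ℤ ℤ fun w => w⁻¹

/-- The bilinear form on `ℤW` with `⟨u, v⟩ = δ_{u,v}` for `u, v ∈ W`. -/
noncomputable def form (X : Cox.{u}) :
    MonoidAlgebra ℤ X.W →ₗ[ℤ] MonoidAlgebra ℤ X.W →ₗ[ℤ] ℤ :=
  LinearMap.mk₂ ℤ (fun x y => ∑ᶠ w : X.W, x.coeff w * y.coeff w)
    (fun x x' y => by
      rw [← finsum_add_distrib (Set.toFinite _) (Set.toFinite _)]
      simp [add_mul])
    (fun a x y => by
      rw [smul_eq_mul, mul_finsum]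
      simp only [coeff_smul, Finsupp.smul_apply, smul_eq_mul, mul_assoc])
    (fun x y y' => by
      rw [← finsum_add_distrib (Set.toFinite _) (Set.toFinite _)]
      simp [mul_add])
    (fun a x y => by
      rw [smul_eq_mul, mul_finsum]
      simp only [coeff_smul, Finsupp.smul_apply, smul_eq_mul, mul_left_comm])

/-! ### The descent algebra, its dual, and the maps `ι` and `χ` -/

/-- The descent class sum `D_I(W) = ∑_{D(w) = I} w`. -/
noncomputable def descentSum (X : Cox.{u}) (I : Set X.B) : MonoidAlgebra ℤ X.W :=
  X.setSum {w | X.descents w = I}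

/-- The descent algebra `Σ(W)`, the `ℤ`-span of `{D_I(W) : I ⊆ S}` (only its module structure is
used). -/
noncomputable def descentAlg (X : Cox.{u}) : Submodule ℤ (MonoidAlgebra ℤ X.W) :=
  Submodule.span ℤ (Set.range X.descentSum)

/-- The dual `Σ^*(W)` of the `ℤ`-module `Σ(W)`. -/
abbrev dualDescent (X : Cox.{u}) : Type u := Module.Dual ℤ X.descentAlg

/-- The inclusion `ι : Σ(W) → ℤW`. -/
noncomputable def iota (X : Cox.{u}) : X.descentAlg →ₗ[ℤ] MonoidAlgebra ℤ X.W :=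
  X.descentAlg.subtype

/-- `χ : ℤW → Σ^*(W)`, `w ↦ D^*_w(W)`, where `D^*_w(W) = D^*_{D(w)}(W)` is the functional that reads
off the coefficient of `D_{D(w)}(W)`, that is, the coefficient of `w` (see `chi_single`). -/
noncomputable def chi (X : Cox.{u}) : MonoidAlgebra ℤ X.W →ₗ[ℤ] X.dualDescent :=
  (X.iota.dualMap : Module.Dual ℤ (MonoidAlgebra ℤ X.W) →ₗ[ℤ] X.dualDescent) ∘ₗ X.form.flip

/-- `χ' = χ ∘ ( )⁻¹ : ℤW → Σ^*(W)`. -/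
noncomputable def chi' (X : Cox.{u}) : MonoidAlgebra ℤ X.W →ₗ[ℤ] X.dualDescent :=
  X.chi ∘ₗ X.invMap

/-- The evaluation pairing `Σ(W) × Σ^*(W) → ℤ`. -/
noncomputable def evalPairing (X : Cox.{u}) : X.descentAlg →ₗ[ℤ] X.dualDescent →ₗ[ℤ] ℤ :=
  Module.Dual.eval ℤ X.descentAlg

open Classical in
theorem form_single (X : Cox.{u}) (u w : X.W) :
    X.form (single u 1) (single w 1) = if u = w then 1 else 0 := by
  rw [form, LinearMap.mk₂_apply, finsum_eq_single _ u]
  · simp [Finsupp.single_apply, eq_comm]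
  · intro v hv
    simp [Finsupp.single_apply, hv.symm]

theorem descentSum_mem (X : Cox.{u}) (I : Set X.B) : X.descentSum I ∈ X.descentAlg :=
  Submodule.subset_span ⟨I, rfl⟩

open Classical in
/-- `⟨D_I(W), D^*_w(W)⟩ = δ_{I, D(w)}`. -/
theorem chi_single (X : Cox.{u}) (w : X.W) (I : Set X.B) :
    X.chi (single w 1) ⟨X.descentSum I, X.descentSum_mem I⟩ =
      if X.descents w = I then 1 else 0 := by
  change X.form (X.descentSum I) (single w 1) = _
  simp only [descentSum, setSum, map_sum, LinearMap.sum_apply, form_single]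
  simp

end Cox

/-! ### Duality of maps and representations of categories -/

/-- With respect to the pairings `p : A × A' → ℤ` and `q : C × C' → ℤ`, the maps `f : A → C` and
`g : C' → A'` are dual to each other: `⟨f a, c'⟩ = ⟨a, g c'⟩`. -/
def DualMaps {A A' C C' : Type*} [AddCommGroup A] [AddCommGroup A'] [AddCommGroup C]
    [AddCommGroup C'] [Module ℤ A] [Module ℤ A'] [Module ℤ C] [Module ℤ C']
    (p : A →ₗ[ℤ] A' →ₗ[ℤ] ℤ) (q : C →ₗ[ℤ] C' →ₗ[ℤ] ℤ)
    (f : A →ₗ[ℤ] C) (g : C' →ₗ[ℤ] A') : Prop :=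
  ∀ (a : A) (c' : C'), q (f a) c' = p a (g c')

/-- Functoriality of an assignment of `ℤ`-modules to objects and linear maps to morphisms. -/
structure IsRep {C : Type v} [Category.{w} C] (obj : C → Type u) [∀ X, AddCommGroup (obj X)]
    [∀ X, Module ℤ (obj X)]
    (map : ∀ {X Y : C}, (X ⟶ Y) → (obj X →ₗ[ℤ] obj Y)) : Prop where
  map_id : ∀ X : C, map (𝟙 X) = LinearMap.id
  map_comp : ∀ {X Y Z : C} (f : X ⟶ Y) (g : Y ⟶ Z), map (f ≫ g) = map g ∘ₗ map f

/-- The representation (covariant functor to `ℤ`-modules) given by a functorial assignment. -/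
def IsRep.functor {C : Type v} [Category.{w} C] {obj : C → Type u} [∀ X, AddCommGroup (obj X)]
    [∀ X, Module ℤ (obj X)]
    {map : ∀ {X Y : C}, (X ⟶ Y) → (obj X →ₗ[ℤ] obj Y)} (h : IsRep obj map) :
    C ⥤ ModuleCat.{u} ℤ where
  obj X := ModuleCat.of ℤ (obj X)
  map f := ModuleCat.ofHom (map f)
  map_id X := by rw [h.map_id]; rfl
  map_comp f g := by rw [h.map_comp]; rfl

/-!
The geometric representation of `W` on the span `V` of the simple roots decides everything: `i` is a
right descent of `w` exactly when `w α_i` is a negative root, and `w α_i` is a positive one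
otherwise. This follows from the rank two case, where the roots have Chebyshev coefficients
`sin (kπ/m) / sin (π/m)`. Since an embedding identifies `V'` with a coordinate subspace of `V`,
signs of roots show that `z ∈ W^I` gives `D(zu) ∩ I = D(u)` for `u ∈ W_I`, which yields both the
uniqueness of `w = zu` and the presentation of `W_I`. Dually, for `z ∈ ^I W` the root `z α_j` is
either a multiple of a simple root `α_i` with `i ∈ I`, and then `j ∈ D(uz)` iff `i ∈ D(u)`, or
`j ∈ D(uz)` does not depend on `u ∈ W_I` (Deodhar's lemma).

In the group algebra, `μ` pulls coefficients back along `w ↦ _I w` while `ρ̄` pushes basis elements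
forward along the same map, so the two are transposes of each other; likewise `μ̄` and `ρ` along
`w ↦ w_I`. The descent algebra consists of the elements whose coefficients are constant on descent
classes; `μ` and `ρ` preserve it by the two facts on descents above. The maps on `Σ^*` are the
transposes of those on `Σ`, and all functoriality comes down to that of `w ↦ _I w` and `w ↦ w_I`,
as `ι` is injective and `χ` is surjective.
-/

namespace Cox

/-! ### The geometric representation -/

section GeometricRepresentation

open CoxeterSystem Polynomial.Chebyshev

variable {B : Type*} (M : CoxeterMatrix B)

/-- The simple root `α_i`, a basis vector of the geometric representation `V = B →₀ ℝ`. -/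
noncomputable def simpleRoot (i : B) : B →₀ ℝ := Finsupp.single i 1

/-- The coroot of `α_i`: the functional `2⟨α_i, ·⟩` for the symmetric bilinear form on `V` with
`⟨α_i, α_j⟩ = -cos (π / m_{ij})`.  As `m_{ij} = ∞` is encoded by `0` and `π / 0 = 0`, the form then
takes the customary value `-1`. -/
noncomputable def coroot (i : B) : Module.Dual ℝ (B →₀ ℝ) :=
  Finsupp.linearCombination ℝ fun j => -(2 * Real.cos (Real.pi / M i j))

theorem coroot_simpleRoot (i j : B) :
    coroot M i (simpleRoot j) = -(2 * Real.cos (Real.pi / M i j)) := by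
  simp [coroot, simpleRoot]

theorem coroot_simpleRoot_self (i : B) : coroot M i (simpleRoot i) = 2 := by
  simp [coroot_simpleRoot]

/-- The reflection `v ↦ v - 2⟨α_i, v⟩α_i` by which the generator `s_i` acts on `V`. -/
noncomputable def simpleReflection (i : B) : (B →₀ ℝ) ≃ₗ[ℝ] (B →₀ ℝ) :=
  Module.reflection (coroot_simpleRoot_self M i)

theorem simpleReflection_apply (i : B) (v : B →₀ ℝ) :
    simpleReflection M i v = v - coroot M i v • simpleRoot i :=
  Module.reflection_apply v _

theorem simpleReflection_mul_self (i : B) : simpleReflection M i * simpleReflection M i = 1 :=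
  LinearEquiv.ext (Module.involutive_reflection (coroot_simpleRoot_self M i))

theorem simpleReflection_simpleRoot_self (i : B) :
    simpleReflection M i (simpleRoot i) = -simpleRoot i :=
  Module.reflection_apply_self (coroot_simpleRoot_self M i)

theorem simpleReflection_simpleRoot (i j : B) : simpleReflection M i (simpleRoot j) =
    simpleRoot j + (2 * Real.cos (Real.pi / M i j)) • simpleRoot i := by
  rw [simpleReflection_apply, coroot_simpleRoot, neg_smul, sub_neg_eq_add]

theorem simpleReflection_apply_of_ne {i j : B} (h : j ≠ i) (v : B →₀ ℝ) :
    simpleReflection M i v j = v j := by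
  simp [simpleReflection_apply, simpleRoot, h.symm]

/-- The coefficients of the roots in the span of `α_i` and `α_j`: the Chebyshev value
`S_n(2 cos θ) = sin ((n + 1)θ) / sin θ` for `θ = π / m`. -/
noncomputable def dihedralCoeff (m : ℕ) (n : ℤ) : ℝ :=
  (S ℝ n).eval (2 * Real.cos (Real.pi / m))

theorem dihedralCoeff_add_one (m : ℕ) (n : ℤ) : dihedralCoeff m (n + 1) =
    2 * Real.cos (Real.pi / m) * dihedralCoeff m n - dihedralCoeff m (n - 1) := by
  simp [dihedralCoeff, S_add_one]

theorem sin_pi_div_pos {m : ℕ} (hm : 2 ≤ m) : 0 < Real.sin (Real.pi / m) := by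
  have hm' : (2 : ℝ) ≤ m := by exact_mod_cast hm
  exact Real.sin_pos_of_pos_of_lt_pi (by positivity) (div_lt_self Real.pi_pos (by linarith))

theorem dihedralCoeff_eq_div {m : ℕ} (hm : 2 ≤ m) (n : ℤ) :
    dihedralCoeff m n = Real.sin ((n + 1) * (Real.pi / m)) / Real.sin (Real.pi / m) :=
  eq_div_of_mul_eq (sin_pi_div_pos hm).ne' (S_two_mul_real_cos _ _)

theorem dihedralCoeff_two_mul {m : ℕ} (hm : 2 ≤ m) : dihedralCoeff m ↑(2 * m) = 1 := by
  have hm' : (m : ℝ) ≠ 0 := by positivity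
  have angle : (((2 * m : ℕ) : ℤ) + 1 : ℝ) * (Real.pi / m) = Real.pi / m + 2 * Real.pi := by
    push_cast
    field_simp
    ring
  rw [dihedralCoeff_eq_div hm, angle, Real.sin_add_two_pi, div_self (sin_pi_div_pos hm).ne']

theorem dihedralCoeff_two_mul_sub_one {m : ℕ} (hm : 2 ≤ m) :
    dihedralCoeff m (↑(2 * m) - 1) = 0 := by
  have hm' : (m : ℝ) ≠ 0 := by positivity
  have angle : ((((2 * m : ℕ) : ℤ) - 1 : ℤ) + 1 : ℝ) * (Real.pi / m) = 2 * Real.pi := by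
    push_cast
    field_simp
    ring
  rw [dihedralCoeff_eq_div hm, angle, Real.sin_two_pi, zero_div]

theorem dihedralCoeff_nonneg {m : ℕ} (hm : m ≠ 1) {n : ℤ} (hn : -1 ≤ n) (h : n < m ∨ m = 0) :
    0 ≤ dihedralCoeff m n := by
  have hn' : (0 : ℝ) ≤ n + 1 := by exact_mod_cast (by omega : (0 : ℤ) ≤ n + 1)
  obtain rfl | hm0 := eq_or_ne m 0
  · simpa [dihedralCoeff] using hn'
  have hm2 : 2 ≤ m := by omega
  have hm' : (n + 1 : ℝ) ≤ m := by exact_mod_cast (by omega : n + 1 ≤ (m : ℤ))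
  rw [dihedralCoeff_eq_div hm2]
  refine div_nonneg (Real.sin_nonneg_of_nonneg_of_le_pi (by positivity) ?_) (sin_pi_div_pos hm2).le
  rw [← mul_div_assoc, div_le_iff₀ (by positivity), mul_comm]
  gcongr

theorem dvd_of_dihedralCoeff {m k : ℕ} (hm : m ≠ 1) (h1 : dihedralCoeff m ↑(2 * k) = 1)
    (h0 : dihedralCoeff m (↑(2 * k) - 1) = 0) : m ∣ k := by
  obtain rfl | hm0 := eq_or_ne m 0
  · simpa [dihedralCoeff] using h1
  have hm2 : 2 ≤ m := by omega
  have hs := (sin_pi_div_pos hm2).ne'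
  rw [dihedralCoeff_eq_div hm2, div_eq_one_iff_eq hs] at h1
  rw [dihedralCoeff_eq_div hm2, div_eq_zero_iff, or_iff_left hs] at h0
  push_cast at h0 h1
  rw [sub_add_cancel] at h0
  rw [add_one_mul, Real.sin_add, h0, zero_mul, zero_add, mul_eq_right₀ hs,
    Real.cos_eq_one_iff] at h1
  obtain ⟨n, hn⟩ := h1
  have hk : (n * m : ℝ) = k := by
    field_simp at hn
    linarith
  exact Int.natCast_dvd_natCast.1 ⟨n, by rw [mul_comm]; exact_mod_cast hk.symm⟩

theorem prod_alternatingWord_simpleRoot (i j : B) (k : ℕ) :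
    ((alternatingWord i j k).map (simpleReflection M)).prod (simpleRoot i) =
      dihedralCoeff (M i j) k • simpleRoot (if Even k then i else j) +
        dihedralCoeff (M i j) (k - 1) • simpleRoot (if Even k then j else i) := by
  induction k with
  | zero => simp [alternatingWord, dihedralCoeff]
  | succ k ih =>
    rw [alternatingWord_succ', List.map_cons, List.prod_cons, LinearEquiv.mul_apply, ih,
      Nat.cast_succ, dihedralCoeff_add_one, add_sub_cancel_right]
    by_cases hk : Even k
    · simp only [hk, Nat.even_add_one, not_true_eq_false, if_true, if_false, map_add, map_smul,
        simpleReflection_simpleRoot_self]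
      rw [simpleReflection_simpleRoot, M.symmetric j i]
      module
    · simp only [hk, Nat.even_add_one, not_false_eq_true, if_true, if_false, map_add, map_smul,
        simpleReflection_simpleRoot_self]
      rw [simpleReflection_simpleRoot]
      module

theorem prod_map_alternatingWord_two_mul {G : Type*} [Monoid G] (r : B → G) (i j : B) (k : ℕ) :
    ((alternatingWord i j (2 * k)).map r).prod = (r i * r j) ^ k := by
  induction k with
  | zero => simp [alternatingWord]
  | succ k ih =>
    rw [mul_add_one, alternatingWord_succ, alternatingWord_succ, List.concat_eq_append,
      List.concat_eq_append, List.map_append, List.map_append, List.prod_append,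
      List.prod_append, ih, pow_succ]
    simp [mul_assoc]

theorem simpleReflection_mul_pow_simpleRoot {i j : B} (h : 2 ≤ M i j) :
    ((simpleReflection M i * simpleReflection M j) ^ M i j) (simpleRoot i) = simpleRoot i := by
  rw [← prod_map_alternatingWord_two_mul, prod_alternatingWord_simpleRoot,
    dihedralCoeff_two_mul h, dihedralCoeff_two_mul_sub_one h]
  simp

theorem exists_sub_mem_ker_coroot {i j : B} (h : 2 ≤ M i j) (v : B →₀ ℝ) :
    ∃ p q : ℝ, coroot M i (v - (p • simpleRoot i + q • simpleRoot j)) = 0 ∧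
      coroot M j (v - (p • simpleRoot i + q • simpleRoot j)) = 0 := by
  have hs := (sin_pi_div_pos h).ne'
  have hc := Real.sin_sq_add_cos_sq (Real.pi / M i j)
  simp only [map_sub, map_add, map_smul, coroot_simpleRoot_self, coroot_simpleRoot,
    M.symmetric j i, smul_eq_mul]
  generalize Real.cos (Real.pi / M i j) = c at *
  generalize Real.sin (Real.pi / M i j) = s at *
  refine ⟨(coroot M i v + c * coroot M j v) / (2 * s ^ 2),
    (coroot M j v + c * coroot M i v) / (2 * s ^ 2), ?_, ?_⟩
  · field_simp
    linear_combination coroot M i v * hc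
  · field_simp
    linear_combination coroot M j v * hc

theorem isLiftable_simpleReflection : M.IsLiftable (simpleReflection M) := by
  intro i j
  obtain rfl | hij := eq_or_ne i j
  · rw [simpleReflection_mul_self, one_pow]
  obtain h0 | h0 := eq_or_ne (M i j) 0
  · rw [h0, pow_zero]
  have h2 : 2 ≤ M i j := by have := M.off_diagonal i j hij; omega
  set T := simpleReflection M i * simpleReflection M j with hT
  have fix_i : (T ^ M i j) (simpleRoot i) = simpleRoot i :=
    simpleReflection_mul_pow_simpleRoot M h2
  have fix_j : (T ^ M i j) (simpleRoot j) = simpleRoot j := by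
    have hinv : simpleReflection M j * simpleReflection M i = T⁻¹ := by
      rw [eq_inv_iff_mul_eq_one, hT, mul_assoc, ← mul_assoc (simpleReflection M i),
        simpleReflection_mul_self, one_mul, simpleReflection_mul_self]
    have := simpleReflection_mul_pow_simpleRoot M (i := j) (j := i) (M.symmetric j i ▸ h2)
    rw [hinv, M.symmetric j i, inv_pow] at this
    exact ((LinearEquiv.symm_apply_eq _).1 this).symm
  ext1 v
  obtain ⟨p, q, hi, hj⟩ := exists_sub_mem_ker_coroot M h2 v
  generalize hw : v - (p • simpleRoot i + q • simpleRoot j) = w at hi hj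
  have fix_w (n : ℕ) : (T ^ n) w = w := by
    induction n with
    | zero => rfl
    | succ n ih =>
      rw [pow_succ, LinearEquiv.mul_apply, hT, LinearEquiv.mul_apply, simpleReflection_apply M j,
        hj, zero_smul, sub_zero, simpleReflection_apply, hi, zero_smul, sub_zero, ← hT, ih]
  rw [sub_eq_iff_eq_add] at hw
  rw [hw, map_add, map_add, map_smul, map_smul, fix_w, fix_i, fix_j]
  rfl

end GeometricRepresentation

/-! ### Signs of roots -/

section RootPositivity

open CoxeterSystem

variable {B W : Type*} [Group W] {M : CoxeterMatrix B} (cs : CoxeterSystem M W)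

/-- The geometric representation of `W` on `V = B →₀ ℝ`, in which descents become signs. -/
noncomputable def geometricRep : W →* ((B →₀ ℝ) ≃ₗ[ℝ] (B →₀ ℝ)) :=
  cs.lift ⟨simpleReflection M, isLiftable_simpleReflection M⟩

theorem geometricRep_simple (i : B) :
    geometricRep cs (cs.simple i) = simpleReflection M i :=
  cs.lift_apply_simple (isLiftable_simpleReflection M) i

theorem geometricRep_wordProd (ω : List B) :
    geometricRep cs (cs.wordProd ω) = (ω.map (simpleReflection M)).prod := by
  rw [wordProd, map_list_prod, List.map_map]
  congr 2
  exact funext (geometricRep_simple cs)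

theorem dvd_of_simple_mul_simple_pow_eq_one {i j : B} {k : ℕ}
    (h : (cs.simple i * cs.simple j) ^ k = 1) : M i j ∣ k := by
  obtain rfl | hij := eq_or_ne i j
  · simp
  have fixed : dihedralCoeff (M i j) ↑(2 * k) • simpleRoot i +
      dihedralCoeff (M i j) (↑(2 * k) - 1) • simpleRoot j = simpleRoot i := by
    have := prod_alternatingWord_simpleRoot M i j (2 * k)
    rw [prod_map_alternatingWord_two_mul, ← geometricRep_simple cs, ← geometricRep_simple cs,
      ← map_mul, ← map_pow, h, map_one] at this
    simpa using this.symm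
  have coeff_i : dihedralCoeff (M i j) ↑(2 * k) = 1 := by
    simpa [simpleRoot, hij.symm] using DFunLike.congr_fun fixed i
  have coeff_j : dihedralCoeff (M i j) (↑(2 * k) - 1) = 0 := by
    simpa [simpleRoot, hij] using DFunLike.congr_fun fixed j
  exact dvd_of_dihedralCoeff (M.off_diagonal i j hij) coeff_i coeff_j

theorem simple_injective : Function.Injective cs.simple := by
  intro i j h
  by_contra hij
  refine M.off_diagonal i j hij (Nat.dvd_one.1 (dvd_of_simple_mul_simple_pow_eq_one cs ?_))
  rw [h, pow_one, simple_mul_simple_self]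

theorem exists_nonneg_geometricRep_alternatingWord {i j : B} (hij : i ≠ j) {k : ℕ}
    (hk : k < M i j ∨ M i j = 0) : ∃ a b : ℝ, 0 ≤ a ∧ 0 ≤ b ∧
      geometricRep cs (cs.wordProd (alternatingWord i j k)) (simpleRoot i) =
        a • simpleRoot i + b • simpleRoot j := by
  have ha : 0 ≤ dihedralCoeff (M i j) k :=
    dihedralCoeff_nonneg (M.off_diagonal i j hij) (by omega) (by omega)
  have hb : 0 ≤ dihedralCoeff (M i j) (k - 1) :=
    dihedralCoeff_nonneg (M.off_diagonal i j hij) (by omega) (by omega)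
  rw [geometricRep_wordProd, prod_alternatingWord_simpleRoot]
  split_ifs
  · exact ⟨_, _, ha, hb, rfl⟩
  · exact ⟨_, _, hb, ha, add_comm _ _⟩

theorem exists_eq_mul_alternatingWord {w : W} {i : B} (hi : ¬ cs.IsRightDescent w i) (j : B) :
    ∃ (z : W) (k : ℕ), w = z * cs.wordProd (alternatingWord i j k) ∧
      cs.length w = cs.length z + k ∧ ¬ cs.IsRightDescent z i ∧ ¬ cs.IsRightDescent z j := by
  induction hn : cs.length w generalizing w i j with
  | zero =>
    rw [length_eq_zero_iff] at hn
    subst hn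
    exact ⟨1, 0, by simp [alternatingWord], by simp, hi, cs.not_isRightDescent_one j⟩
  | succ n ih =>
    by_cases hj : cs.IsRightDescent w j
    · have hlen := cs.isRightDescent_iff.1 hj
      obtain ⟨z, k, hw, hk, hzj, hzi⟩ :=
        ih (cs.isRightDescent_iff_not_isRightDescent_mul.1 hj) i (by omega)
      refine ⟨z, k + 1, ?_, by omega, hzi, hzj⟩
      rw [alternatingWord_succ, wordProd_concat, ← mul_assoc, ← hw,
        simple_mul_simple_cancel_right]
    · exact ⟨w, 0, by simp [alternatingWord], by simp [hn], hi, hj⟩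

theorem lt_of_not_isRightDescent_mul_alternatingWord {z : W} {i j : B} {k : ℕ}
    (hk : cs.length (z * cs.wordProd (alternatingWord i j k)) = cs.length z + k)
    (hi : ¬ cs.IsRightDescent (z * cs.wordProd (alternatingWord i j k)) i) :
    k < M i j ∨ M i j = 0 := by
  by_contra! hlt
  rw [not_isRightDescent_iff, hk, mul_assoc, ← wordProd_concat, ← alternatingWord_succ] at hi
  refine cs.not_isReduced_alternatingWord j i (m := k + 1) (M.symmetric j i ▸ hlt.2)
    (by rw [M.symmetric j i]; omega) (le_antisymm (cs.length_wordProd_le _) ?_)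
  have := cs.length_mul_le z (cs.wordProd (alternatingWord j i (k + 1)))
  rw [length_alternatingWord]
  omega

theorem geometricRep_simpleRoot_nonneg {w : W} {i : B} (hi : ¬ cs.IsRightDescent w i) :
    0 ≤ geometricRep cs w (simpleRoot i) := by
  induction hn : cs.length w using Nat.strong_induction_on generalizing w i with
  | _ n ih =>
    obtain rfl | hw := eq_or_ne w 1
    · simp [simpleRoot]
    obtain ⟨j, hj⟩ := cs.exists_rightDescent_of_ne_one hw
    obtain ⟨z, k, rfl, hk, hzi, hzj⟩ := exists_eq_mul_alternatingWord cs hi j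
    have hk0 : k ≠ 0 := by
      rintro rfl
      simp_all [alternatingWord]
    obtain ⟨a, b, ha, hb, hab⟩ := exists_nonneg_geometricRep_alternatingWord cs
      (by rintro rfl; exact hi hj) (lt_of_not_isRightDescent_mul_alternatingWord cs hk hi)
    rw [map_mul, LinearEquiv.mul_apply, hab, map_add, map_smul, map_smul]
    exact add_nonneg (smul_nonneg ha (ih _ (by omega) hzi rfl))
      (smul_nonneg hb (ih _ (by omega) hzj rfl))

theorem geometricRep_mul_simple_simpleRoot (w : W) (i : B) :
    geometricRep cs (w * cs.simple i) (simpleRoot i) = -geometricRep cs w (simpleRoot i) := by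
  rw [map_mul, LinearEquiv.mul_apply, geometricRep_simple, simpleReflection_simpleRoot_self,
    map_neg]

theorem geometricRep_simpleRoot_ne_zero (w : W) (i : B) :
    geometricRep cs w (simpleRoot i) ≠ 0 := by
  simp [simpleRoot]

theorem isRightDescent_iff_geometricRep_nonpos (w : W) (i : B) :
    cs.IsRightDescent w i ↔ geometricRep cs w (simpleRoot i) ≤ 0 := by
  constructor
  · intro h
    have := geometricRep_simpleRoot_nonneg cs (cs.isRightDescent_iff_not_isRightDescent_mul.1 h)
    rwa [geometricRep_mul_simple_simpleRoot, neg_nonneg] at this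
  · intro h
    by_contra hi
    exact geometricRep_simpleRoot_ne_zero cs w i
      (le_antisymm h (geometricRep_simpleRoot_nonneg cs hi))

theorem exists_geometricRep_eq_smul_of_isRightDescent_simple_mul {w : W} {j k : B}
    (hk : ¬ cs.IsRightDescent w k) (hjk : cs.IsRightDescent (cs.simple j * w) k) :
    ∃ c : ℝ, 0 < c ∧ geometricRep cs w (simpleRoot k) = c • simpleRoot j := by
  have nonneg := geometricRep_simpleRoot_nonneg cs hk
  rw [isRightDescent_iff_geometricRep_nonpos, map_mul, LinearEquiv.mul_apply,
    geometricRep_simple] at hjk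
  set v := geometricRep cs w (simpleRoot k)
  have hvj : v = v j • simpleRoot j := by
    ext b
    obtain rfl | hb := eq_or_ne b j
    · simp [simpleRoot]
    · have hle : v b ≤ 0 := simpleReflection_apply_of_ne M hb v ▸ hjk b
      simpa [simpleRoot, hb.symm] using le_antisymm hle (nonneg b)
  have hj0 : 0 ≤ v j := nonneg j
  refine ⟨v j, hj0.lt_of_ne fun h0 => ?_, hvj⟩
  rw [← h0, zero_smul] at hvj
  exact geometricRep_simpleRoot_ne_zero cs w k hvj

end RootPositivity

/-! ### Parabolic subsystems -/

section Parabolic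

open CoxeterSystem

variable {B W ι G : Type*} [Group W] [Group G] {M : CoxeterMatrix B} {N : CoxeterMatrix ι}
  (cs : CoxeterSystem M W) (cg : CoxeterSystem N G) {g : ι → B} {φ : G →* W}

theorem range_of_map_simple (hφ : ∀ i, φ (cg.simple i) = cs.simple (g i)) :
    φ.range = Subgroup.closure (cs.simple '' Set.range g) := by
  rw [MonoidHom.range_eq_map, ← cg.subgroup_closure_range_simple, MonoidHom.map_closure,
    ← Set.range_comp, ← Set.range_comp]
  congr 2
  exact funext hφ

theorem geometricRep_mapDomain (hN : ∀ i j, N i j = M (g i) (g j))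
    (hφ : ∀ i, φ (cg.simple i) = cs.simple (g i)) (u : G) (v : ι →₀ ℝ) :
    geometricRep cs (φ u) (v.mapDomain g) = (geometricRep cg u v).mapDomain g := by
  induction u using cg.simple_induction_left generalizing v with
  | one => simp
  | mul_simple_left u i ih =>
    have coroot_eq (v : ι →₀ ℝ) : coroot M (g i) (v.mapDomain g) = coroot N i v := by
      simp only [coroot, Finsupp.linearCombination_mapDomain]
      congr 2
      exact funext fun j => by rw [Function.comp_apply, hN]
    rw [map_mul, map_mul, map_mul, LinearEquiv.mul_apply, LinearEquiv.mul_apply, ih, hφ,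
      geometricRep_simple, geometricRep_simple, simpleReflection_apply, simpleReflection_apply,
      coroot_eq, Finsupp.mapDomain_sub]
    simp [simpleRoot]

theorem geometricRep_mapDomain_nonneg {z : W} (hz : ∀ i, ¬ cs.IsRightDescent z (g i))
    {v : ι →₀ ℝ} (hv : 0 ≤ v) : 0 ≤ geometricRep cs z (v.mapDomain g) := by
  simp only [Finsupp.mapDomain, Finsupp.sum, map_sum]
  refine Finset.sum_nonneg fun i _ => ?_
  rw [← mul_one (v i), ← smul_eq_mul, ← Finsupp.smul_single, map_smul]
  exact smul_nonneg (hv i) (geometricRep_simpleRoot_nonneg cs (hz i))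

theorem isRightDescent_mul_map_iff (hN : ∀ i j, N i j = M (g i) (g j))
    (hφ : ∀ i, φ (cg.simple i) = cs.simple (g i)) {z : W}
    (hz : ∀ i, ¬ cs.IsRightDescent z (g i)) (u : G) (i : ι) :
    cs.IsRightDescent (z * φ u) (g i) ↔ cg.IsRightDescent u i := by
  have rep_eq : geometricRep cs (z * φ u) (simpleRoot (g i)) =
      geometricRep cs z ((geometricRep cg u (simpleRoot i)).mapDomain g) := by
    rw [← geometricRep_mapDomain cs cg hN hφ, map_mul, LinearEquiv.mul_apply]
    simp [simpleRoot]
  by_cases hu : cg.IsRightDescent u i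
  · refine iff_of_true ?_ hu
    have hneg := (isRightDescent_iff_geometricRep_nonpos cg u i).1 hu
    have := geometricRep_mapDomain_nonneg cs hz (neg_nonneg.2 hneg)
    rwa [← neg_one_smul ℝ, Finsupp.mapDomain_smul, neg_one_smul, map_neg, neg_nonneg, ← rep_eq,
      ← isRightDescent_iff_geometricRep_nonpos] at this
  · refine iff_of_false (fun h => geometricRep_simpleRoot_ne_zero cs (z * φ u) (g i) ?_) hu
    refine le_antisymm ((isRightDescent_iff_geometricRep_nonpos cs _ _).1 h) ?_
    rw [rep_eq]
    exact geometricRep_mapDomain_nonneg cs hz (geometricRep_simpleRoot_nonneg cg hu)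

theorem isRightDescent_map_iff (hN : ∀ i j, N i j = M (g i) (g j))
    (hφ : ∀ i, φ (cg.simple i) = cs.simple (g i)) (u : G) (i : ι) :
    cs.IsRightDescent (φ u) (g i) ↔ cg.IsRightDescent u i := by
  simpa using isRightDescent_mul_map_iff cs cg hN hφ (fun i => cs.not_isRightDescent_one (g i)) u i

theorem injective_of_map_simple (hN : ∀ i j, N i j = M (g i) (g j))
    (hφ : ∀ i, φ (cg.simple i) = cs.simple (g i)) : Function.Injective φ := by
  rw [injective_iff_map_eq_one]
  intro u hu
  by_contra hne
  obtain ⟨i, hi⟩ := cg.exists_rightDescent_of_ne_one hne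
  rw [← isRightDescent_map_iff cs cg hN hφ, hu] at hi
  exact cs.not_isRightDescent_one _ hi

theorem length_mul_map (hN : ∀ i j, N i j = M (g i) (g j))
    (hφ : ∀ i, φ (cg.simple i) = cs.simple (g i)) {z : W}
    (hz : ∀ i, ¬ cs.IsRightDescent z (g i)) (u : G) :
    cs.length (z * φ u) = cs.length z + cg.length u := by
  induction hn : cg.length u generalizing u with
  | zero =>
    rw [cg.length_eq_zero_iff] at hn
    simp [hn]
  | succ n ih =>
    obtain ⟨i, hi⟩ : ∃ i, cg.IsRightDescent u i :=
      cg.exists_rightDescent_of_ne_one (by rintro rfl; simp at hn)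
    have hui := cg.isRightDescent_iff.1 hi
    have hwi := cs.isRightDescent_iff.1 ((isRightDescent_mul_map_iff cs cg hN hφ hz u i).2 hi)
    have := ih (u * cg.simple i) (by omega)
    rw [map_mul, hφ, ← mul_assoc] at this
    omega

theorem length_map_mul (hN : ∀ i j, N i j = M (g i) (g j))
    (hφ : ∀ i, φ (cg.simple i) = cs.simple (g i)) {z : W}
    (hz : ∀ i, ¬ cs.IsRightDescent z⁻¹ (g i)) (u : G) :
    cs.length (φ u * z) = cg.length u + cs.length z := by
  rw [← cs.length_inv, mul_inv_rev, ← map_inv, length_mul_map cs cg hN hφ hz, cs.length_inv,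
    cg.length_inv, add_comm]

theorem isRightDescent_map_mul_dichotomy (hN : ∀ i j, N i j = M (g i) (g j))
    (hφ : ∀ i, φ (cg.simple i) = cs.simple (g i)) {z : W}
    (hz : ∀ i, ¬ cs.IsRightDescent z⁻¹ (g i)) (j : B) :
    (∀ u, cs.IsRightDescent (φ u * z) j ↔ cs.IsRightDescent z j) ∨
      ∃ i, ∀ u, cs.IsRightDescent (φ u * z) j ↔ cg.IsRightDescent u i := by
  by_cases hzj : ∀ i, ¬ cs.IsRightDescent (z * cs.simple j)⁻¹ (g i)
  · refine .inl fun u => ?_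
    rw [IsRightDescent, mul_assoc, length_map_mul cs cg hN hφ hzj, length_map_mul cs cg hN hφ hz,
      Nat.add_lt_add_iff_left, IsRightDescent]
  · push Not at hzj
    obtain ⟨i, hi⟩ := hzj
    rw [mul_inv_rev, inv_simple] at hi
    obtain ⟨c, hc, hzi⟩ :=
      exists_geometricRep_eq_smul_of_isRightDescent_simple_mul cs (hz i) hi
    have hzj : c • geometricRep cs z (simpleRoot j) = simpleRoot (g i) := by
      rw [← map_smul, ← hzi, ← LinearEquiv.mul_apply, ← map_mul, mul_inv_cancel, map_one,
        LinearEquiv.coe_one, id]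
    refine .inr ⟨i, fun u => ?_⟩
    rw [← isRightDescent_map_iff cs cg hN hφ, isRightDescent_iff_geometricRep_nonpos,
      isRightDescent_iff_geometricRep_nonpos, ← hzj, map_smul, map_mul, LinearEquiv.mul_apply,
      smul_nonpos_iff_nonpos_of_pos_left hc]

end Parabolic

/-! ### Embeddings -/

variable {X Y Z : Cox.{u}}

theorem homOf_injective (f : X ⟶ Y) : Function.Injective (homOf f) := Emb.injective f

theorem homOf_id (u : X.W) : homOf (𝟙 X) u = u := rfl

theorem homOf_comp (f : X ⟶ Y) (g : Y ⟶ Z) (u : X.W) :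
    homOf (f ≫ g) u = homOf g (homOf f u) := rfl

/-- The map of index sets `S' → S` underlying an embedding `(W', S') ↪ (W, S)`. -/
noncomputable def indexMap (f : X ⟶ Y) (i : X.B) : Y.B := (Emb.map_simple f i).choose

theorem homOf_simple (f : X ⟶ Y) (i : X.B) :
    homOf f (X.cs.simple i) = Y.cs.simple (indexMap f i) := (Emb.map_simple f i).choose_spec

theorem indexMap_comp (f : X ⟶ Y) (g : Y ⟶ Z) (i : X.B) :
    indexMap (f ≫ g) i = indexMap g (indexMap f i) := by
  apply simple_injective Z.cs
  rw [← homOf_simple, ← homOf_simple, ← homOf_simple, homOf_comp]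

theorem matrix_indexMap (f : X ⟶ Y) (i j : X.B) : X.M i j = Y.M (indexMap f i) (indexMap f j) := by
  apply Nat.dvd_antisymm
  · apply dvd_of_simple_mul_simple_pow_eq_one X.cs
    apply homOf_injective f
    rw [map_pow, map_mul, homOf_simple, homOf_simple, Y.cs.simple_mul_simple_pow, map_one]
  · apply dvd_of_simple_mul_simple_pow_eq_one Y.cs
    rw [← homOf_simple, ← homOf_simple, ← map_mul, ← map_pow, X.cs.simple_mul_simple_pow, map_one]

theorem support_eq_range (f : X ⟶ Y) : support f = Set.range (indexMap f) := by
  ext j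
  exact exists_congr fun i => by rw [homOf_simple, (simple_injective Y.cs).eq_iff]

theorem mem_leftReps_support (f : X ⟶ Y) {z : Y.W} :
    z ∈ Y.leftReps (support f) ↔ ∀ i, ¬ Y.cs.IsRightDescent z (indexMap f i) := by
  rw [support_eq_range, leftReps, Set.mem_ofPred_eq, Set.subset_compl_comm, Set.range_subset_iff]
  rfl

theorem inv_mem_leftReps (I : Set Y.B) {z : Y.W} : z⁻¹ ∈ Y.leftReps I ↔ z ∈ Y.rightReps I := Iff.rfl

theorem indexMap_mem_descents_mul_homOf (f : X ⟶ Y) {z : Y.W}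
    (hz : z ∈ Y.leftReps (support f)) (u : X.W) (i : X.B) :
    indexMap f i ∈ Y.descents (z * homOf f u) ↔ i ∈ X.descents u :=
  isRightDescent_mul_map_iff Y.cs X.cs (matrix_indexMap f) (homOf_simple f)
    ((mem_leftReps_support f).1 hz) u i

theorem eq_one_of_mul_homOf_mem_leftReps (f : X ⟶ Y) {z : Y.W} (hz : z ∈ Y.leftReps (support f))
    {u : X.W} (hu : z * homOf f u ∈ Y.leftReps (support f)) : u = 1 := by
  by_contra hne
  obtain ⟨i, hi⟩ := X.cs.exists_rightDescent_of_ne_one hne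
  exact (mem_leftReps_support f).1 hu i ((indexMap_mem_descents_mul_homOf f hz u i).2 hi)

theorem mul_homOf_inj (f : X ⟶ Y) {z z' : Y.W} (hz : z ∈ Y.leftReps (support f))
    (hz' : z' ∈ Y.leftReps (support f)) {u u' : X.W} (h : z * homOf f u = z' * homOf f u') :
    z = z' ∧ u = u' := by
  have hzz' : z * homOf f (u * u'⁻¹) = z' := by
    rw [map_mul, map_inv, ← mul_assoc, h, mul_inv_cancel_right]
  have huu' := eq_one_of_mul_homOf_mem_leftReps f hz (hzz' ▸ hz')
  rw [mul_inv_eq_one] at huu'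
  subst huu'
  exact ⟨mul_right_cancel h, rfl⟩

theorem homOf_mul_inj (f : X ⟶ Y) {z z' : Y.W} (hz : z ∈ Y.rightReps (support f))
    (hz' : z' ∈ Y.rightReps (support f)) {u u' : X.W} (h : homOf f u * z = homOf f u' * z') :
    z = z' ∧ u = u' := by
  have hinv := congrArg (·⁻¹) h
  simp only [mul_inv_rev, ← map_inv] at hinv
  obtain ⟨hzz', huu'⟩ :=
    mul_homOf_inj f ((inv_mem_leftReps _).2 hz) ((inv_mem_leftReps _).2 hz') hinv
  exact ⟨inv_injective hzz', inv_injective huu'⟩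

theorem leftFactor_spec (f : X ⟶ Y) (w : Y.W) :
    ∃ z ∈ Y.leftReps (support f), w = z * homOf f (leftFactor f w) :=
  (exists_leftFactor f w).choose_spec

theorem rightFactor_spec (f : X ⟶ Y) (w : Y.W) :
    ∃ z ∈ Y.rightReps (support f), w = homOf f (rightFactor f w) * z :=
  (exists_rightFactor f w).choose_spec

theorem existsUnique_leftFactorization (f : X ⟶ Y) (w : Y.W) :
    ∃! p : Y.W × X.W, p.1 ∈ Y.leftReps (support f) ∧ w = p.1 * homOf f p.2 := by
  obtain ⟨z, hz, hw⟩ := leftFactor_spec f w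
  refine ⟨(z, leftFactor f w), ⟨hz, hw⟩, ?_⟩
  rintro ⟨z', u⟩ ⟨hz', hw'⟩
  exact Prod.ext_iff.2 (mul_homOf_inj f hz' hz (hw'.symm.trans hw))

theorem existsUnique_rightFactorization (f : X ⟶ Y) (w : Y.W) :
    ∃! p : X.W × Y.W, p.2 ∈ Y.rightReps (support f) ∧ w = homOf f p.1 * p.2 := by
  obtain ⟨z, hz, hw⟩ := rightFactor_spec f w
  refine ⟨(rightFactor f w, z), ⟨hz, hw⟩, ?_⟩
  rintro ⟨u, z'⟩ ⟨hz', hw'⟩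
  exact Prod.ext_iff.2 (homOf_mul_inj f hz' hz (hw'.symm.trans hw)).symm

theorem leftFactor_mul_homOf (f : X ⟶ Y) {z : Y.W} (hz : z ∈ Y.leftReps (support f)) (u : X.W) :
    leftFactor f (z * homOf f u) = u := by
  obtain ⟨z', hz', hw⟩ := leftFactor_spec f (z * homOf f u)
  exact (mul_homOf_inj f hz hz' hw).2.symm

theorem leftFactor_inv (f : X ⟶ Y) (w : Y.W) : leftFactor f w⁻¹ = (rightFactor f w)⁻¹ := by
  obtain ⟨z, hz, hw⟩ := rightFactor_spec f w
  conv_lhs => rw [hw, mul_inv_rev, ← map_inv]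
  exact leftFactor_mul_homOf f ((inv_mem_leftReps _).2 hz) _

theorem mul_inv_homOf_mem_leftReps_iff (f : X ⟶ Y) (w : Y.W) (u : X.W) :
    w * (homOf f u)⁻¹ ∈ Y.leftReps (support f) ↔ u = leftFactor f w := by
  constructor
  · intro h
    simpa using (leftFactor_mul_homOf f h u).symm
  · rintro rfl
    obtain ⟨z, hz, hw⟩ := leftFactor_spec f w
    rwa [← eq_mul_inv_of_mul_eq hw.symm]

theorem inv_homOf_mul_mem_rightReps_iff (f : X ⟶ Y) (w : Y.W) (u : X.W) :
    (homOf f u)⁻¹ * w ∈ Y.rightReps (support f) ↔ u = rightFactor f w := by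
  rw [← inv_mem_leftReps, mul_inv_rev, ← map_inv (homOf f) u, mul_inv_homOf_mem_leftReps_iff,
    leftFactor_inv, inv_inj]

theorem leftFactor_id (w : X.W) : leftFactor (𝟙 X) w = w := by
  have one_mem : (1 : X.W) ∈ X.leftReps (support (𝟙 X)) :=
    (mem_leftReps_support _).2 fun _ => X.cs.not_isRightDescent_one _
  simpa [homOf_id] using leftFactor_mul_homOf (𝟙 X) one_mem w

theorem leftFactor_comp (f : X ⟶ Y) (g : Y ⟶ Z) (w : Z.W) :
    leftFactor (f ≫ g) w = leftFactor f (leftFactor g w) := by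
  obtain ⟨z, hz, hw⟩ := leftFactor_spec g w
  obtain ⟨y, hy, hu⟩ := leftFactor_spec f (leftFactor g w)
  have mul_mem : z * homOf g y ∈ Z.leftReps (support (f ≫ g)) := by
    rw [mem_leftReps_support] at hy ⊢
    intro i
    rw [indexMap_comp]
    exact mt (indexMap_mem_descents_mul_homOf g hz y _).1 (hy i)
  rw [eq_comm, ← mul_inv_homOf_mem_leftReps_iff]
  convert mul_mem using 1
  rw [mul_inv_eq_iff_eq_mul, homOf_comp, mul_assoc, ← map_mul, ← hu, ← hw]

theorem rightFactor_id (w : X.W) : rightFactor (𝟙 X) w = w := by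
  rw [← inv_inj, ← leftFactor_inv, leftFactor_id]

theorem rightFactor_comp (f : X ⟶ Y) (g : Y ⟶ Z) (w : Z.W) :
    rightFactor (f ≫ g) w = rightFactor f (rightFactor g w) := by
  rw [← inv_inj, ← leftFactor_inv, ← leftFactor_inv, ← leftFactor_inv, leftFactor_comp]

theorem descents_leftFactor_congr (f : X ⟶ Y) {w w' : Y.W} (h : Y.descents w = Y.descents w') :
    X.descents (leftFactor f w) = X.descents (leftFactor f w') := by
  have descents_eq (w : Y.W) : X.descents (leftFactor f w) = indexMap f ⁻¹' Y.descents w := by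
    obtain ⟨z, hz, hw⟩ := leftFactor_spec f w
    ext i
    rw [← indexMap_mem_descents_mul_homOf f hz, ← hw, Set.mem_preimage]
  rw [descents_eq, descents_eq, h]

theorem descents_homOf_mul_congr (f : X ⟶ Y) {z : Y.W} (hz : z ∈ Y.rightReps (support f))
    {u u' : X.W} (h : X.descents u = X.descents u') :
    Y.descents (homOf f u * z) = Y.descents (homOf f u' * z) := by
  ext j
  obtain hj | ⟨i, hi⟩ := isRightDescent_map_mul_dichotomy Y.cs X.cs (matrix_indexMap f)
    (homOf_simple f) ((mem_leftReps_support f).1 hz) j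
  · exact (hj u).trans (hj u').symm
  · exact (hi u).trans ((Set.ext_iff.1 h i).trans (hi u').symm)

theorem exists_parabolic_coxeterSystem (X : Cox.{u}) (I : Set X.B) :
    ∃ c : CoxeterSystem (restrictMatrix X.M I) (X.parabolic I),
      ∀ i : I, (c.simple i : X.W) = X.cs.simple i := by
  let cg := (restrictMatrix X.M I).toCoxeterSystem
  have isLiftable : (restrictMatrix X.M I).IsLiftable fun i : I => X.cs.simple i :=
    fun i j => X.cs.simple_mul_simple_pow i j
  let φ := cg.lift ⟨_, isLiftable⟩
  have hφ : ∀ i : I, φ (cg.simple i) = X.cs.simple i := cg.lift_apply_simple isLiftable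
  have injective : Function.Injective φ := injective_of_map_simple X.cs cg (fun _ _ => rfl) hφ
  have range_eq : φ.range = X.parabolic I := by
    rw [range_of_map_simple X.cs cg hφ, Subtype.range_coe, parabolic]
  exact ⟨cg.map ((MonoidHom.ofInjective injective).trans (MulEquiv.subgroupCongr range_eq)), hφ⟩

theorem exists_subsystem_hom (X : Cox.{u}) (I : Set X.B) :
    ∃ (c : CoxeterSystem (restrictMatrix X.M I) (X.parabolic I)) (f : X.subsystem I c ⟶ X),
      homOf f = (X.parabolic I).subtype ∧ ∀ i : I, (c.simple i : X.W) = X.cs.simple i := by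
  obtain ⟨c, hc⟩ := X.exists_parabolic_coxeterSystem I
  exact ⟨c, ⟨(X.parabolic I).subtype, Subtype.val_injective, fun i => ⟨i.1, hc i⟩⟩, rfl, hc⟩

end Cox

theorem DualMaps.flip {A A' C C' : Type*} [AddCommGroup A] [AddCommGroup A'] [AddCommGroup C]
    [AddCommGroup C'] {p : A →ₗ[ℤ] A' →ₗ[ℤ] ℤ} {q : C →ₗ[ℤ] C' →ₗ[ℤ] ℤ}
    {f : A →ₗ[ℤ] C} {g : C' →ₗ[ℤ] A'} (h : DualMaps p q f g) :
    DualMaps q.flip p.flip g f := fun c' a => (h a c').symm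

namespace IsRep

variable {C : Type v} [Category.{w} C] {obj obj' : C → Type u}
  [∀ X, AddCommGroup (obj X)] [∀ X, AddCommGroup (obj' X)]
  {map : ∀ {X Y : C}, (X ⟶ Y) → (obj X →ₗ[ℤ] obj Y)}
  {map' : ∀ {X Y : C}, (X ⟶ Y) → (obj' X →ₗ[ℤ] obj' Y)}
  {t : ∀ X, obj X →ₗ[ℤ] obj' X}

theorem of_injective (h : IsRep obj' map') (t_injective : ∀ X, Function.Injective (t X))
    (ht : ∀ {X Y : C} (f : X ⟶ Y), t Y ∘ₗ map f = map' f ∘ₗ t X) : IsRep obj map where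
  map_id X := by
    rw [← LinearMap.cancel_left (t_injective X), ht, h.map_id]
    rfl
  map_comp {X Y Z} f g := by
    rw [← LinearMap.cancel_left (t_injective Z), ht, h.map_comp, ← LinearMap.comp_assoc, ht,
      LinearMap.comp_assoc, LinearMap.comp_assoc, ht]

theorem of_surjective (h : IsRep obj map) (t_surjective : ∀ X, Function.Surjective (t X))
    (ht : ∀ {X Y : C} (f : X ⟶ Y), t Y ∘ₗ map f = map' f ∘ₗ t X) : IsRep obj' map' where
  map_id X := by
    rw [← LinearMap.cancel_right (t_surjective X), ← ht, h.map_id]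
    rfl
  map_comp {X Y Z} f g := by
    rw [← LinearMap.cancel_right (t_surjective X), ← ht, h.map_comp, LinearMap.comp_assoc, ← ht,
      ← LinearMap.comp_assoc, ht, LinearMap.comp_assoc]

theorem exists_natTrans (h : IsRep obj map) (h' : IsRep obj' map')
    (ht : ∀ {X Y : C} (f : X ⟶ Y), t Y ∘ₗ map f = map' f ∘ₗ t X) :
    ∃ T : h.functor ⟶ h'.functor, ∀ X, T.app X = ModuleCat.ofHom (t X) :=
  ⟨{ app := fun X => ModuleCat.ofHom (t X)
     naturality := fun _ _ f => ModuleCat.hom_ext (ht f) }, fun _ => rfl⟩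

end IsRep

namespace Cox

variable {X Y Z : Cox.{u}}

/-! ### Coefficients and duality in the group algebra -/

theorem linearMap_ext {N : Type*} [AddCommGroup N] {F G : MonoidAlgebra ℤ X.W →ₗ[ℤ] N}
    (h : ∀ w, F (single w 1) = G (single w 1)) : F = G :=
  lhom_ext' fun w => LinearMap.ext_ring (h w)

theorem form_apply_single (x : MonoidAlgebra ℤ X.W) (w : X.W) :
    X.form x (single w 1) = x.coeff w := by
  rw [form, LinearMap.mk₂_apply, finsum_eq_single _ w]
  · simp
  · intro v hv
    simp [hv.symm]

theorem form_flip : X.form.flip = X.form := by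
  refine LinearMap.ext₂ fun x y => ?_
  rw [LinearMap.flip_apply, form, LinearMap.mk₂_apply, LinearMap.mk₂_apply]
  exact finsum_congr fun w => mul_comm _ _

theorem form_bijective : Function.Bijective X.form := by
  have := Fintype.ofFinite X.W
  constructor
  · intro x y h
    ext w
    rw [← form_apply_single, h, form_apply_single]
  · intro F
    refine ⟨∑ w, F (single w 1) • single w 1, linearMap_ext fun w => ?_⟩
    rw [form_apply_single]
    classical simp [coeff_sum, Finsupp.single_apply]

theorem form_isPerfPair : X.form.IsPerfPair where
  bijective_left := form_bijective
  bijective_right := form_flip.symm ▸ form_bijective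

theorem evalPairing_isPerfPair : X.evalPairing.IsPerfPair where
  bijective_left := Module.bijective_dual_eval ℤ _
  bijective_right := Function.bijective_id

theorem dualMaps_mapDomainLinearMap (h : Y.W → X.W)
    {G : MonoidAlgebra ℤ X.W →ₗ[ℤ] MonoidAlgebra ℤ Y.W}
    (coeff_G : ∀ x w, (G x).coeff w = x.coeff (h w)) :
    DualMaps X.form Y.form G (mapDomainLinearMap ℤ ℤ h) := by
  intro x y
  suffices key : Y.form (G x) = X.form x ∘ₗ mapDomainLinearMap ℤ ℤ h from
    LinearMap.congr_fun key y
  refine linearMap_ext fun w => ?_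
  rw [LinearMap.comp_apply, mapDomainLinearMap_single, form_apply_single, form_apply_single,
    coeff_G]

theorem dualMaps_form_symm {F : MonoidAlgebra ℤ X.W →ₗ[ℤ] MonoidAlgebra ℤ Y.W}
    {G : MonoidAlgebra ℤ Y.W →ₗ[ℤ] MonoidAlgebra ℤ X.W} (h : DualMaps X.form Y.form F G) :
    DualMaps Y.form X.form G F := by
  simpa only [form_flip] using h.flip

theorem coeff_invMap (x : MonoidAlgebra ℤ X.W) (w : X.W) :
    (X.invMap x).coeff w = x.coeff w⁻¹ := by
  simpa [invMap] using Finsupp.mapDomain_apply inv_injective x.coeff w⁻¹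

theorem invMap_bijective : Function.Bijective X.invMap :=
  Function.Involutive.bijective fun x => by
    ext w
    rw [coeff_invMap, coeff_invMap, inv_inv]

theorem dualMaps_invMap : DualMaps X.form X.form X.invMap X.invMap :=
  dualMaps_mapDomainLinearMap _ coeff_invMap

open Classical in
theorem coeff_setSum (A : Set X.W) (w : X.W) : (X.setSum A).coeff w = if w ∈ A then 1 else 0 := by
  simp [setSum, coeff_sum, Finsupp.single_apply]

theorem coeff_mu (f : X ⟶ Y) (x : MonoidAlgebra ℤ X.W) (w : Y.W) :
    (mu f x).coeff w = x.coeff (leftFactor f w) := by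
  classical
  induction x using MonoidAlgebra.induction_linear with
  | zero => simp
  | add x y hx hy => simp [hx, hy]
  | single u r =>
    simp [mu, coeff_setSum, mul_inv_homOf_mem_leftReps_iff, Finsupp.single_apply]

theorem coeff_muBar (f : X ⟶ Y) (x : MonoidAlgebra ℤ X.W) (w : Y.W) :
    (muBar f x).coeff w = x.coeff (rightFactor f w) := by
  classical
  induction x using MonoidAlgebra.induction_linear with
  | zero => simp
  | add x y hx hy => simp [hx, hy]
  | single u r =>
    simp [muBar, coeff_setSum, inv_homOf_mul_mem_rightReps_iff, Finsupp.single_apply]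

theorem muBar_single (f : X ⟶ Y) (u : X.W) :
    muBar f (single u 1) = ∑ z ∈ (Y.rightReps (support f)).toFinite.toFinset,
      single (homOf f u * z) 1 := by
  simp [muBar, setSum, Finset.mul_sum, single_mul_single]

theorem dualMaps_mu_rhoBar (f : X ⟶ Y) : DualMaps X.form Y.form (mu f) (rhoBar f) :=
  dualMaps_mapDomainLinearMap _ (coeff_mu f)

theorem dualMaps_muBar_rho (f : X ⟶ Y) : DualMaps X.form Y.form (muBar f) (rho f) :=
  dualMaps_mapDomainLinearMap _ (coeff_muBar f)

theorem invMap_comp_mu (f : X ⟶ Y) : Y.invMap ∘ₗ mu f = muBar f ∘ₗ X.invMap := by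
  refine LinearMap.ext fun x => ?_
  ext w
  simp only [LinearMap.comp_apply, coeff_invMap, coeff_mu, coeff_muBar, leftFactor_inv]

theorem invMap_comp_rho (f : X ⟶ Y) : X.invMap ∘ₗ rho f = rhoBar f ∘ₗ Y.invMap :=
  linearMap_ext fun w => by
    simp only [LinearMap.comp_apply, rho, rhoBar, invMap, mapDomainLinearMap_single,
      leftFactor_inv]

theorem isRep_mu : IsRep (fun X : Cox.{u} => MonoidAlgebra ℤ X.W) (fun f => mu f) where
  map_id X := by
    refine LinearMap.ext fun x => ?_
    ext w
    rw [coeff_mu, leftFactor_id, LinearMap.id_apply]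
  map_comp f g := by
    refine LinearMap.ext fun x => ?_
    ext w
    simp only [LinearMap.comp_apply, coeff_mu, leftFactor_comp]

theorem isRep_muBar : IsRep (fun X : Cox.{u} => MonoidAlgebra ℤ X.W) (fun f => muBar f) :=
  isRep_mu.of_surjective (fun _ => invMap_bijective.surjective) fun f => invMap_comp_mu f

theorem isRep_rho :
    IsRep (fun X : Cox.{u}ᵒᵖ => MonoidAlgebra ℤ X.unop.W) (fun f => rho f.unop) where
  map_id X := linearMap_ext fun w => by
    simp only [rho, mapDomainLinearMap_single, unop_id, rightFactor_id, LinearMap.id_apply]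
  map_comp f g := linearMap_ext fun w => by
    simp only [rho, LinearMap.comp_apply, mapDomainLinearMap_single, unop_comp, rightFactor_comp]

theorem isRep_rhoBar :
    IsRep (fun X : Cox.{u}ᵒᵖ => MonoidAlgebra ℤ X.unop.W) (fun f => rhoBar f.unop) :=
  isRep_rho.of_surjective (fun _ => invMap_bijective.surjective) fun f => invMap_comp_rho f.unop

/-! ### Descent algebra -/

open Classical in
theorem coeff_descentSum (J : Set X.B) (w : X.W) :
    (X.descentSum J).coeff w = if X.descents w = J then 1 else 0 :=
  coeff_setSum _ w

theorem coeff_eq_of_mem_descentAlg {x : MonoidAlgebra ℤ X.W} (hx : x ∈ X.descentAlg) {w w' : X.W}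
    (h : X.descents w = X.descents w') : x.coeff w = x.coeff w' := by
  induction hx using Submodule.span_induction with
  | mem x hx =>
    obtain ⟨J, rfl⟩ := hx
    rw [coeff_descentSum, coeff_descentSum, h]
  | zero => rfl
  | add x y _ _ hx hy => simp only [coeff_add, Finsupp.add_apply, hx, hy]
  | smul a x _ hx => simp only [coeff_smul, Finsupp.smul_apply, hx]

theorem eq_sum_descentSum [Fintype (Set.range X.descents)] {x : MonoidAlgebra ℤ X.W}
    (hx : ∀ w w', X.descents w = X.descents w' → x.coeff w = x.coeff w') :
    x = ∑ J : Set.range X.descents,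
      x.coeff (Set.rangeSplitting X.descents J) • X.descentSum J := by
  classical
  ext w
  rw [coeff_sum, Finsupp.finsetSum_apply, Finset.sum_eq_single ⟨X.descents w, w, rfl⟩]
  · rw [coeff_smul, Finsupp.smul_apply, coeff_descentSum, if_pos rfl, smul_eq_mul, mul_one]
    exact hx _ _ (Set.apply_rangeSplitting X.descents ⟨X.descents w, w, rfl⟩).symm
  · intro J _ hJ
    rw [coeff_smul, Finsupp.smul_apply, coeff_descentSum, smul_eq_mul,
      if_neg fun h => hJ (Subtype.ext h.symm), mul_zero]
  · exact fun h => absurd (Finset.mem_univ _) h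

theorem mem_descentAlg_iff {x : MonoidAlgebra ℤ X.W} :
    x ∈ X.descentAlg ↔ ∀ w w', X.descents w = X.descents w' → x.coeff w = x.coeff w' := by
  refine ⟨fun hx w w' => coeff_eq_of_mem_descentAlg hx, fun hx => ?_⟩
  have := Fintype.ofFinite (Set.range X.descents)
  rw [eq_sum_descentSum hx]
  exact sum_mem fun J _ => Submodule.smul_mem _ _ (X.descentSum_mem J)

theorem exists_retraction_iota (X : Cox.{u}) :
    ∃ r : MonoidAlgebra ℤ X.W →ₗ[ℤ] X.descentAlg, r ∘ₗ X.iota = LinearMap.id := by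
  have := Fintype.ofFinite (Set.range X.descents)
  refine ⟨∑ J : Set.range X.descents,
    (X.form.flip (single (Set.rangeSplitting X.descents J) 1)).smulRight
      ⟨X.descentSum J, X.descentSum_mem J⟩, ?_⟩
  ext x : 2
  conv_rhs => rw [LinearMap.id_apply, eq_sum_descentSum (mem_descentAlg_iff.1 x.2)]
  simp only [LinearMap.comp_apply, LinearMap.sum_apply, LinearMap.smulRight_apply,
    LinearMap.flip_apply, form_apply_single, iota, Submodule.subtype_apply,
    AddSubmonoidClass.coe_finsetSum, SetLike.val_smul]

theorem chi_surjective : Function.Surjective X.chi := by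
  obtain ⟨r, hr⟩ := X.exists_retraction_iota
  intro F
  obtain ⟨x, hx⟩ := form_isPerfPair.bijective_right.surjective (F ∘ₗ r)
  exact ⟨x, by rw [chi, LinearMap.comp_apply, hx, LinearMap.dualMap_apply', LinearMap.comp_assoc,
    hr, LinearMap.comp_id]⟩

theorem mu_mem_descentAlg (f : X ⟶ Y) {x : MonoidAlgebra ℤ X.W} (hx : x ∈ X.descentAlg) :
    mu f x ∈ Y.descentAlg := by
  rw [mem_descentAlg_iff] at hx ⊢
  intro w w' h
  rw [coeff_mu, coeff_mu]
  exact hx _ _ (descents_leftFactor_congr f h)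

theorem coeff_rho (f : X ⟶ Y) (x : MonoidAlgebra ℤ Y.W) (u : X.W) :
    (rho f x).coeff u =
      ∑ z ∈ (Y.rightReps (support f)).toFinite.toFinset, x.coeff (homOf f u * z) := by
  rw [← form_apply_single, dualMaps_form_symm (dualMaps_muBar_rho f), muBar_single, map_sum]
  simp only [form_apply_single]

theorem rho_mem_descentAlg (f : X ⟶ Y) {x : MonoidAlgebra ℤ Y.W} (hx : x ∈ Y.descentAlg) :
    rho f x ∈ X.descentAlg := by
  rw [mem_descentAlg_iff] at hx ⊢
  intro u u' h
  rw [coeff_rho, coeff_rho]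
  refine Finset.sum_congr rfl fun z hz => ?_
  exact hx _ _ (descents_homOf_mul_congr f ((Set.Finite.mem_toFinset _).1 hz) h)

/-- The map `μ_I^S : Σ(W_I) → Σ(W)`, the restriction of `μ_I^S : ℤW_I → ℤW` to descent algebras. -/
noncomputable def muDescent (f : X ⟶ Y) : X.descentAlg →ₗ[ℤ] Y.descentAlg :=
  (mu f).restrict fun _ => mu_mem_descentAlg f

/-- The map `ρ_I^S : Σ(W) → Σ(W_I)`, the restriction of `ρ_I^S : ℤW → ℤW_I` to descent algebras. -/
noncomputable def rhoDescent (f : X ⟶ Y) : Y.descentAlg →ₗ[ℤ] X.descentAlg :=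
  (rho f).restrict fun _ => rho_mem_descentAlg f

/-- The map `μ̄_I^S : Σ^*(W_I) → Σ^*(W)` that `μ̄_I^S : ℤW_I → ℤW` induces along `χ`, encoded as the
transpose of `ρ_I^S : Σ(W) → Σ(W_I)`. -/
noncomputable def muDual (f : X ⟶ Y) : X.dualDescent →ₗ[ℤ] Y.dualDescent := (rhoDescent f).dualMap

/-- The map `ρ̄_I^S : Σ^*(W) → Σ^*(W_I)` that `ρ̄_I^S : ℤW → ℤW_I` induces along `χ`, encoded as the
transpose of `μ_I^S : Σ(W_I) → Σ(W)`. -/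
noncomputable def rhoDual (f : X ⟶ Y) : Y.dualDescent →ₗ[ℤ] X.dualDescent := (muDescent f).dualMap

theorem chi_comp_muBar (f : X ⟶ Y) : Y.chi ∘ₗ muBar f = muDual f ∘ₗ X.chi :=
  LinearMap.ext₂ fun x y => (dualMaps_form_symm (dualMaps_muBar_rho f) (Y.iota y) x).symm

theorem chi_comp_rhoBar (f : X ⟶ Y) : X.chi ∘ₗ rhoBar f = rhoDual f ∘ₗ Y.chi :=
  LinearMap.ext₂ fun y x => (dualMaps_mu_rhoBar f (X.iota x) y).symm

theorem chi'_comp_mu (f : X ⟶ Y) : Y.chi' ∘ₗ mu f = muDual f ∘ₗ X.chi' := by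
  rw [chi', chi', LinearMap.comp_assoc, invMap_comp_mu, ← LinearMap.comp_assoc, chi_comp_muBar,
    LinearMap.comp_assoc]

theorem chi'_comp_rho (f : X ⟶ Y) : X.chi' ∘ₗ rho f = rhoDual f ∘ₗ Y.chi' := by
  rw [chi', chi', LinearMap.comp_assoc, invMap_comp_rho, ← LinearMap.comp_assoc, chi_comp_rhoBar,
    LinearMap.comp_assoc]

theorem iota_injective : Function.Injective X.iota := Subtype.val_injective

theorem isRep_muDescent : IsRep (fun X : Cox.{u} => X.descentAlg) (fun f => muDescent f) :=
  isRep_mu.of_injective (fun _ => iota_injective) fun _ => rfl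

theorem isRep_muDual : IsRep (fun X : Cox.{u} => X.dualDescent) (fun f => muDual f) :=
  isRep_muBar.of_surjective (fun _ => chi_surjective) fun f => chi_comp_muBar f

theorem isRep_rhoDescent :
    IsRep (fun X : Cox.{u}ᵒᵖ => X.unop.descentAlg) (fun f => rhoDescent f.unop) :=
  isRep_rho.of_injective (fun _ => iota_injective) fun _ => rfl

theorem isRep_rhoDual :
    IsRep (fun X : Cox.{u}ᵒᵖ => X.unop.dualDescent) (fun f => rhoDual f.unop) :=
  isRep_rhoBar.of_surjective (fun _ => chi_surjective) fun f => chi_comp_rhoBar f.unop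

end Cox

theorem theorem2 :
    -- every `I ⊆ S` gives a parabolic subsystem `(W_I, I)`, whose inclusion is a morphism
    (∀ (X : Cox.{u}) (I : Set X.B),
      ∃ (c : CoxeterSystem (Cox.restrictMatrix X.M I) (X.parabolic I))
        (f : X.subsystem I c ⟶ X), Cox.homOf f = (X.parabolic I).subtype ∧
        ∀ i : I, (c.simple i : X.W) = X.cs.simple i) ∧
    -- the factors `w_I` and `_I w` are uniquely determined
    (∀ (X Y : Cox.{u}) (f : X ⟶ Y) (w : Y.W),
      (∃! p : X.W × Y.W, p.2 ∈ Y.rightReps (Cox.support f) ∧ w = Cox.homOf f p.1 * p.2) ∧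
      (∃! p : Y.W × X.W, p.1 ∈ Y.leftReps (Cox.support f) ∧ w = p.1 * Cox.homOf f p.2)) ∧
    -- the maps on `Σ` and on `Σ^*`
    ∃ (muS : ∀ {X Y : Cox.{u}}, (X ⟶ Y) → (X.descentAlg →ₗ[ℤ] Y.descentAlg))
      (rhoS : ∀ {X Y : Cox.{u}}, (X ⟶ Y) → (Y.descentAlg →ₗ[ℤ] X.descentAlg))
      (muD : ∀ {X Y : Cox.{u}}, (X ⟶ Y) → (X.dualDescent →ₗ[ℤ] Y.dualDescent))
      (rhoD : ∀ {X Y : Cox.{u}}, (X ⟶ Y) → (Y.dualDescent →ₗ[ℤ] X.dualDescent)),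
      -- the six squares of the diagram commute
      (∀ (X Y : Cox.{u}) (f : X ⟶ Y),
        Y.iota ∘ₗ muS f = Cox.mu f ∘ₗ X.iota ∧
        Y.invMap ∘ₗ Cox.mu f = Cox.muBar f ∘ₗ X.invMap ∧
        Y.chi ∘ₗ Cox.muBar f = muD f ∘ₗ X.chi ∧
        X.iota ∘ₗ rhoS f = Cox.rho f ∘ₗ Y.iota ∧
        X.invMap ∘ₗ Cox.rho f = Cox.rhoBar f ∘ₗ Y.invMap ∧
        X.chi ∘ₗ Cox.rhoBar f = rhoD f ∘ₗ Y.chi) ∧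
      -- the horizontal arrows are injective, bijective, surjective
      (∀ X : Cox.{u}, Function.Injective X.iota ∧ Function.Bijective X.invMap ∧
        Function.Surjective X.chi) ∧
      -- rotating the diagram by 180 degrees gives the dual diagram
      (∀ X : Cox.{u}, X.form.IsPerfPair ∧ X.evalPairing.IsPerfPair ∧
        DualMaps X.evalPairing X.form X.iota X.chi ∧
        DualMaps X.form X.form X.invMap X.invMap) ∧
      (∀ (X Y : Cox.{u}) (f : X ⟶ Y),
        DualMaps X.evalPairing Y.evalPairing (muS f) (rhoD f) ∧
        DualMaps Y.evalPairing X.evalPairing (rhoS f) (muD f) ∧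
        DualMaps X.form Y.form (Cox.mu f) (Cox.rhoBar f) ∧
        DualMaps Y.form X.form (Cox.rho f) (Cox.muBar f) ∧
        DualMaps X.form Y.form (Cox.muBar f) (Cox.rho f) ∧
        DualMaps Y.form X.form (Cox.rhoBar f) (Cox.mu f)) ∧
      -- representations `Σ`, `Ω`, `Ω^*`, `Σ^*` of `Cox`, and the natural transformations
      (∃ (hS : IsRep (fun X : Cox.{u} => X.descentAlg) (fun f => muS f))
         (hO : IsRep (fun X : Cox.{u} => MonoidAlgebra ℤ X.W) (fun f => Cox.mu f))
         (hO' : IsRep (fun X : Cox.{u} => MonoidAlgebra ℤ X.W) (fun f => Cox.muBar f))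
         (hD : IsRep (fun X : Cox.{u} => X.dualDescent) (fun f => muD f)),
        (∃ t : hS.functor ⟶ hO.functor, ∀ X, t.app X = ModuleCat.ofHom X.iota) ∧
        (∃ t : hO'.functor ⟶ hD.functor, ∀ X, t.app X = ModuleCat.ofHom X.chi) ∧
        (∃ t : hO.functor ⟶ hD.functor, ∀ X, t.app X = ModuleCat.ofHom X.chi')) ∧
      -- the same for the opposite category
      (∃ (hS : IsRep (fun X : Cox.{u}ᵒᵖ => X.unop.descentAlg) (fun f => rhoS f.unop))
         (hO : IsRep (fun X : Cox.{u}ᵒᵖ => MonoidAlgebra ℤ X.unop.W) (fun f => Cox.rho f.unop))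
         (hO' : IsRep (fun X : Cox.{u}ᵒᵖ => MonoidAlgebra ℤ X.unop.W)
           (fun f => Cox.rhoBar f.unop))
         (hD : IsRep (fun X : Cox.{u}ᵒᵖ => X.unop.dualDescent) (fun f => rhoD f.unop)),
        (∃ t : hS.functor ⟶ hO.functor, ∀ X, t.app X = ModuleCat.ofHom X.unop.iota) ∧
        (∃ t : hO'.functor ⟶ hD.functor, ∀ X, t.app X = ModuleCat.ofHom X.unop.chi) ∧
        (∃ t : hO.functor ⟶ hD.functor, ∀ X, t.app X = ModuleCat.ofHom X.unop.chi')) := by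
  refine ⟨Cox.exists_subsystem_hom, fun X Y f w =>
    ⟨Cox.existsUnique_rightFactorization f w, Cox.existsUnique_leftFactorization f w⟩,
    Cox.muDescent, Cox.rhoDescent, Cox.muDual, Cox.rhoDual, ?_, ?_, ?_, ?_, ?_, ?_⟩
  · intro X Y f
    exact ⟨rfl, Cox.invMap_comp_mu f, Cox.chi_comp_muBar f, rfl, Cox.invMap_comp_rho f,
      Cox.chi_comp_rhoBar f⟩
  · intro X
    exact ⟨Cox.iota_injective, Cox.invMap_bijective, Cox.chi_surjective⟩
  · intro X
    exact ⟨Cox.form_isPerfPair, Cox.evalPairing_isPerfPair, fun _ _ => rfl, Cox.dualMaps_invMap⟩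
  · intro X Y f
    exact ⟨fun _ _ => rfl, fun _ _ => rfl, Cox.dualMaps_mu_rhoBar f,
      Cox.dualMaps_form_symm (Cox.dualMaps_muBar_rho f), Cox.dualMaps_muBar_rho f,
      Cox.dualMaps_form_symm (Cox.dualMaps_mu_rhoBar f)⟩
  · exact ⟨Cox.isRep_muDescent, Cox.isRep_mu, Cox.isRep_muBar, Cox.isRep_muDual,
      IsRep.exists_natTrans _ _ fun _ => rfl,
      IsRep.exists_natTrans _ _ fun f => Cox.chi_comp_muBar f,
      IsRep.exists_natTrans _ _ fun f => Cox.chi'_comp_mu f⟩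
  · exact ⟨Cox.isRep_rhoDescent, Cox.isRep_rho, Cox.isRep_rhoBar, Cox.isRep_rhoDual,
      IsRep.exists_natTrans _ _ fun _ => rfl,
      IsRep.exists_natTrans _ _ fun f => Cox.chi_comp_rhoBar f.unop,
      IsRep.exists_natTrans _ _ fun f => Cox.chi'_comp_rho f.unop⟩
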